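/- Let $\mathcal S=\{(\hat\rho_x,p_x)\}_{x\in\mathcal X}$ be a quantum source with finite alphabet $\mathcal X$, probabilities $p_x$ and density operators $\hat\rho_x$ on a finite-dimensional complex Hilbert space $\mathcal H$. Let $\hat\rho=\sum_x p_x\hat\rho_x$, let $S(\cdot)$ be the von Neumann entropy (logarithms in base $2$) and $\chi(\mathcal S)=S(\hat\rho)-\sum_x p_xS(\hat\rho_x)$ the Holevo information. Fix spectral decompositions $\hat\rho=\sum_j\lambda_j|e_j\rangle\langle e_j|$ and $\hat\rho_x=\sum_j\lambda_{j|x}|e_{j|x}\rangle\langle e_{j|x}|$. For $\delta>0$ and $N\in\mathbb N$ let $\hat\Pi$ be the projector onto the span of the vectors $|e_{j_1}\rangle\otimes\cdots\otimes|e_{j_N}\rangle$ with $\lambda_{j_1}\cdots\lambda_{j_N}>0$ and $\left|-\frac1N\log\prod_n\lambda_{j_n}-S(\hat\rho)\right|\le\delta$ (typical subspace). For $\mathbf x\in\mathcal X^N$ let $\hat\rho_{\mathbf x}=\bigotimes_n\hat\rho_{x_n}$, and let $\mathcal H_{\delta,N}(\mathbf x)$ be the span of the vectors $|e_{j_1|x_1}\rangle\otimes\cdots\otimes|e_{j_N|x_N}\rangle$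 with $\prod_n\lambda_{j_n|x_n}>0$ and $\left|-\frac1N\log\prod_n\lambda_{j_n|x_n}-\sum_xp_xS(\hat\rho_x)\right|\le\delta$ (conditionally-typical subspace). Let $R\ge0$ and $u_F=\lceil NR\rceil$. A code $\mathcal C=(\mathbf x^{(\mathbf k)})_{\mathbf k\in\{0,1\}^{u_F}}$ consists of $M=2^{u_F}$ words in $\mathcal X^N$, and $\langle\cdot\rangle_{\mathcal S}$ is the average over codes with respect to $P(\mathcal C)=\prod_{\mathbf k}\prod_n p_{x^{(\mathbf k)}_n}$; write $\hat\rho_{\mathbf k}=\hat\rho_{\mathbf x^{(\mathbf k)}}$. The orthogonal-projections binary-tree decoder performs $u_F$ binary measurements: at step $u\in\{1,\dots,u_F\}$, after outcomes $k_1,\dots,k_{u-1}$, its elements are $\hat T^{(u)}_{k_1\cdots k_{u-1},0}$, the projector onto the span of the subspaces $\mathcal H_{\delta,N}(\mathbf x^{(\mathbf k')})$ over all labels $\mathbf k'$ that begin with $k_1\cdots k_{u-1}0$, and $\hat T^{(u)}_{k_1\cdots k_{u-1},1}=\hat{\mathbf 1}-\hat T^{(u)}_{k_1\cdots k_{u-1},0}$.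 The resulting nested POVM has elements $\hat G_{\mathbf k}=\left|\sqrt{\hat T^{(u_F)}_{k_1\cdots k_{u_F}}}\cdots\sqrt{\hat T^{(1)}_{k_1}}\right|^2$, and $P_{succ}(\mathcal C)=\frac1M\sum_{\mathbf k}\operatorname{Tr}[\hat G_{\mathbf k}\hat\rho_{\mathbf k}]$. Then: (1) For all $\delta>0$ and $R\ge 0$ with $R<\chi(\mathcal S)-2\delta$, the decoder fulfills the sufficient capacity-achieving condition: there is $\epsilon(N)>0$ with $N^2\epsilon(N)\to0$ as $N\to\infty$ such that for all $N$, all $\mathbf k\in\{0,1\}^{u_F}$ and all $u\in\{1,\dots,u_F\}$ $$\left\langle\operatorname{Tr}\left[\hat T^{(u)}_{k_1\cdots k_u}\hat\Pi\hat\rho_{\mathbf k}\hat\Pi\right]\right\rangle_{\mathcal S}\ge1-\epsilon(N);$$ and consequently $\lim_{N\to\infty}\langle P_{succ}(\mathcal C)\rangle_{\mathcal S}=1$. (2) Hence the scheme attains the Holevo bound with only $\lceil NR\rceil$ binary steps: for every $0\le R<\chi(\mathcal S)$ there are $\delta>0$ and codes $\mathcal C_N$ of length $N$ with $2^{\lceil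 NR\rceil}$ words for which this decoder has $P_{succ}(\mathcal C_N)\to1$ as $N\to\infty$. -/

import Mathlib

open scoped MatrixOrder ComplexOrder

noncomputable section

namespace HolevoTree

/-- A quantum source with finite alphabet `X`: letter probabilities `p x` together with density
matrices `ρ x` on the Hilbert space `ℂ^d`. -/
structure QSource (X d : Type*) [Fintype X] [Fintype d] where
  p : X → ℝ
  p_nonneg : ∀ x, 0 ≤ p x
  p_sum : ∑ x, p x = 1
  ρ : X → Matrix d d ℂ
  ρ_pos : ∀ x, (ρ x).PosSemidef
  ρ_trace : ∀ x, (ρ x).trace = 1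

/-- Von Neumann entropy in bits of a Hermitian matrix: the Shannon entropy of its spectrum
(a zero eigenvalue contributes `0`). -/
def entropy {d : Type*} [Fintype d] [DecidableEq d] {A : Matrix d d ℂ} (hA : A.IsHermitian) : ℝ :=
  -∑ j, hA.eigenvalues j * Real.logb 2 (hA.eigenvalues j)

/-- The product vector `v₁ ⊗ ⋯ ⊗ v_N` in `(ℂ^d)^{⊗N}`, realised as `ℂ^(d^N)`. -/
def tensorVec {d : Type*} [Fintype d] {N : ℕ} (v : Fin N → EuclideanSpace ℂ d) :
    EuclideanSpace ℂ (Fin N → d) :=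
  WithLp.toLp 2 fun i => ∏ n, v n (i n)

/-- The product operator `A₁ ⊗ ⋯ ⊗ A_N`. -/
def tensorMat {d : Type*} {N : ℕ} (A : Fin N → Matrix d d ℂ) :
    Matrix (Fin N → d) (Fin N → d) ℂ :=
  Matrix.of fun i j => ∏ n, A n (i n) (j n)

/-- The matrix of the orthogonal projector onto a subspace. -/
def projMat {ι : Type*} [Fintype ι] [DecidableEq ι] (U : Submodule ℂ (EuclideanSpace ℂ ι)) :
    Matrix ι ι ℂ :=
  (Matrix.toEuclideanCLM (n := ι) (𝕜 := ℂ)).symm U.starProjection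

theorem isStarProjection_projMat {ι : Type*} [Fintype ι] [DecidableEq ι]
    (U : Submodule ℂ (EuclideanSpace ℂ ι)) : IsStarProjection (projMat U) :=
  (isStarProjection_starProjection (U := U)).map
    (Matrix.toEuclideanCLM (n := ι) (𝕜 := ℂ)).symm

namespace QSource

variable {X d : Type*} [Fintype X] [Fintype d] (S : QSource X d)

/-- The average state `∑ₓ pₓ ρₓ` of the source. -/
def avgState : Matrix d d ℂ := ∑ x, (S.p x : ℂ) • S.ρ x

theorem avgState_isHermitian : S.avgState.IsHermitian := by
  unfold avgState Matrix.IsHermitian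
  rw [Matrix.conjTranspose_sum]
  refine Finset.sum_congr rfl fun x _ => ?_
  rw [Matrix.conjTranspose_smul, (S.ρ_pos x).1.eq, Complex.star_def, Complex.conj_ofReal]

variable [DecidableEq d]

/-- The average entropy `∑ₓ pₓ S(ρₓ)`. -/
def condEntropy : ℝ := ∑ x, S.p x * entropy (S.ρ_pos x).1

/-- The Holevo information `χ(S) = S(∑ₓ pₓ ρₓ) - ∑ₓ pₓ S(ρₓ)`. -/
def holevo : ℝ := entropy S.avgState_isHermitian - S.condEntropy

/-- Labels `j ∈ J^N` that are `δ`-typical for the spectrum `λ` of the average state: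
`|-(1/N) log₂ ∏ₙ λ_{jₙ} - S(ρ)| ≤ δ`. A sequence of probability zero has infinite
sample entropy, so it is not typical. -/
def typicalSet (δ : ℝ) (N : ℕ) : Set (Fin N → d) :=
  {j | (∀ n, 0 < S.avgState_isHermitian.eigenvalues (j n)) ∧
    |-(1 / (N : ℝ)) * ∑ n, Real.logb 2 (S.avgState_isHermitian.eigenvalues (j n))
      - entropy S.avgState_isHermitian| ≤ δ}

/-- The `δ`-typical subspace of the source. -/
def typicalSpace (δ : ℝ) (N : ℕ) : Submodule ℂ (EuclideanSpace ℂ (Fin N → d)) :=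
  Submodule.span ℂ
    ((fun j => tensorVec fun n => S.avgState_isHermitian.eigenvectorBasis (j n)) ''
      S.typicalSet δ N)

/-- Labels `j` that are `δ`-conditionally typical given the letter sequence `x`. -/
def condTypicalSet (δ : ℝ) {N : ℕ} (x : Fin N → X) : Set (Fin N → d) :=
  {j | (∀ n, 0 < (S.ρ_pos (x n)).1.eigenvalues (j n)) ∧
    |-(1 / (N : ℝ)) * ∑ n, Real.logb 2 ((S.ρ_pos (x n)).1.eigenvalues (j n))
      - S.condEntropy| ≤ δ}

/-- The `δ`-conditionally-typical subspace given the letter sequence `x`. -/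
def condTypicalSpace (δ : ℝ) {N : ℕ} (x : Fin N → X) :
    Submodule ℂ (EuclideanSpace ℂ (Fin N → d)) :=
  Submodule.span ℂ
    ((fun j => tensorVec fun n => (S.ρ_pos (x n)).1.eigenvectorBasis (j n)) ''
      S.condTypicalSet δ x)

end QSource

/-- A code of `2^m` codewords of length `N`, labelled by bit strings of length `m`. -/
abbrev Codebook (X : Type*) (N m : ℕ) := (Fin m → Bool) → (Fin N → X)

section Random

variable {X d : Type*} [Fintype X] [Fintype d] (S : QSource X d)

/-- The quantum codeword `ρ_{x₁} ⊗ ⋯ ⊗ ρ_{x_N}`. -/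
def codeState {N : ℕ} (x : Fin N → X) : Matrix (Fin N → d) (Fin N → d) ℂ :=
  tensorMat fun n => S.ρ (x n)

/-- Probability of a code whose letters are all sampled independently from the source. -/
def codeProb {N m : ℕ} (C : Codebook X N m) : ℝ := ∏ k, ∏ n, S.p (C k n)

/-- Average of `f` over random codes. -/
def codeAvg {N m : ℕ} (f : Codebook X N m → ℝ) : ℝ :=
  ∑ C : Codebook X N m, codeProb S C * f C

end Random

/-- A two-outcome POVM on `ℂ^ι`. -/
structure BinaryPOVM (ι : Type*) [Fintype ι] [DecidableEq ι] where
  B : Bool → Matrix ι ι ℂ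
  pos : ∀ b, (B b).PosSemidef
  complete : B false + B true = 1

/-- An adaptive binary-tree measurement with `m` steps: at the step preceded by `u` outcomes
(`u = 0, …, m - 1`) a binary POVM is chosen depending on those outcomes. -/
abbrev BinaryTree (m : ℕ) (ι : Type*) [Fintype ι] [DecidableEq ι] :=
  (u : Fin m) → (Fin u → Bool) → BinaryPOVM ι

/-- The first `u` bits of `k`. -/
def bitPrefix {m : ℕ} (k : Fin m → Bool) (u : Fin m) : Fin u → Bool :=
  fun i => k (Fin.castLE u.isLt.le i)

namespace BinaryTree

variable {m : ℕ} {ι : Type*} [Fintype ι] [DecidableEq ι] (T : BinaryTree m ι)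

/-- The element met at step `u` on the path leading to the outcome string `k`: it is the
`k u`-element of the POVM selected by the bits before `u`. -/
def elem (k : Fin m → Bool) (u : Fin m) : Matrix ι ι ℂ :=
  (T u (bitPrefix k u)).B (k u)

/-- `√T_m ⋯ √T_1` along the path `k`; the last step is the leftmost factor. -/
def pathOp (k : Fin m → Bool) : Matrix ι ι ℂ :=
  (List.ofFn fun u => CFC.sqrt (T.elem k u)).reverse.prod

/-- The element `|√T_m ⋯ √T_1|²` of the nested POVM with outcome string `k`. -/
def nested (k : Fin m → Bool) : Matrix ι ι ℂ :=
  (T.pathOp k).conjTranspose * T.pathOp k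

end BinaryTree

section Decoder

variable {X d : Type*} [Fintype X] [Fintype d] [DecidableEq d] (S : QSource X d)

/-- The probability `(1/M) ∑_k Tr[G_k ρ_k]` that the tree `T` identifies a uniformly chosen
codeword of `C`, where `M = 2^m`. -/
def successProb {N m : ℕ} (C : Codebook X N m) (T : BinaryTree m (Fin N → d)) : ℝ :=
  (1 / (2 : ℝ) ^ m) * ∑ k, (T.nested k * codeState S (C k)).trace.re

/-- Labels of the codewords that start with the bits `w` followed by the bit `b`. -/
def subcode {m : ℕ} (u : Fin m) (w : Fin u → Bool) (b : Bool) : Set (Fin m → Bool) :=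
  {k | bitPrefix k u = w ∧ k u = b}

/-- The span of the conditionally-typical subspaces of the codewords whose label starts with
`w` followed by `0`. -/
def zeroSpace (δ : ℝ) {N m : ℕ} (C : Codebook X N m) (u : Fin m) (w : Fin u → Bool) :
    Submodule ℂ (EuclideanSpace ℂ (Fin N → d)) :=
  ⨆ k ∈ subcode u w false, S.condTypicalSpace δ (C k)

/-- The orthogonal-projections decoder: outcome `0` is the projector onto `zeroSpace`, outcome
`1` its complement. -/
def projDecoder (δ : ℝ) {N m : ℕ} (C : Codebook X N m) : BinaryTree m (Fin N → d) :=
  fun u w =>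
    { B := fun b => bif b then 1 - projMat (zeroSpace S δ C u w)
        else projMat (zeroSpace S δ C u w)
      pos := by
        have h := isStarProjection_projMat (zeroSpace S δ C u w)
        rintro (_ | _)
        · exact Matrix.nonneg_iff_posSemidef.mp h.nonneg
        · exact Matrix.nonneg_iff_posSemidef.mp h.one_sub.nonneg
      complete := by simp }

/-- The condition on a decoding scheme (a tree for each block length `N` and each code with
`2^(m N)` codewords) that on average over random codes every element on the path of a codeword
`k` accepts `Π ρ_k Π` with probability at least `1 - ε`, where `ε > 0` depends on `N` only and
decays faster than `N⁻²`; here `Π` is the projector onto the `δ`-typical subspace. -/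
def SufficientCondition (δ : ℝ) (m : ℕ → ℕ)
    (T : (N : ℕ) → Codebook X N (m N) → BinaryTree (m N) (Fin N → d)) : Prop :=
  ∃ ε : ℕ → ℝ, (∀ N, 0 < ε N) ∧
    ε =o[Filter.atTop] (fun N : ℕ => ((N : ℝ) ^ 2)⁻¹) ∧
    ∀ (N : ℕ) (k : Fin (m N) → Bool) (u : Fin (m N)),
      1 - ε N ≤ codeAvg S fun C : Codebook X N (m N) =>
        ((T N C).elem k u *
          (projMat (S.typicalSpace δ N) * codeState S (C k)
            * projMat (S.typicalSpace δ N))).trace.re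

end Decoder

/-- The number of bits `⌈N R⌉` of a code of length `N` and rate `R`. -/
def numBits (R : ℝ) (N : ℕ) : ℕ := ⌈(N : ℝ) * R⌉₊

end HolevoTree

end

/-! Every state involved is a tensor product, so in a product eigenbasis `Re Tr[B† B A]` is an
average of `‖B v_j‖²` with weights `prodEig` (`trace_mul_tensorMat`). Decoding thus becomes a
question about how far unit vectors move under projections.

At one step there are two cases. If the bit is `0`, the accepted subspace contains the conditionally
typical subspace of the sent codeword, so the losses come only from atypicality; a Chernoff bound
makes them exponentially small at any rate (`codeAvg_elem_zero_ge`). If the bit is `1`, the rejected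
subspace is independent of the sent codeword, which may be redrawn and averaged to the `N`-fold
average state. On the typical subspace that state has eigenvalues at most `2^(-N(S(ρ)-δ))`, while
the rejected subspace has dimension at most `2^m · 2^(N(∑ pₓS(ρₓ)+δ))`; the overlap decays
exponentially when `R < χ - 2δ` (`codeAvg_elem_one_ge`).

Steps are combined by a union bound for sequential projections (`norm_seqProj_ofFn_sq_ge`): the
displacement is at most the sum of the `m` individual defects, and Cauchy–Schwarz turns this into a
loss governed by `m² ε`. Since `m = O(N)`, the decay `N² ε → 0` suffices. Finally, some code does at
least as well as the average. -/

namespace HolevoTree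

/-! ### Large deviations and resampling for independent finite samples. -/

section Probability

open Filter Topology

theorem sum_pi_prod {Ω : Type*} [Fintype Ω] (N : ℕ) (g : Ω → ℝ) :
    ∑ ω : Fin N → Ω, ∏ n, g (ω n) = (∑ a, g a) ^ N := by
  classical
  have := (Finset.prod_univ_sum (fun _ : Fin N => (Finset.univ : Finset Ω))
    (fun _ a => g a)).symm
  simpa [Fintype.piFinset_univ] using this

theorem sum_pi_prod_eq_one {Ω : Type*} [Fintype Ω] (N : ℕ) {w : Ω → ℝ} (h1 : ∑ a, w a = 1) :
    ∑ ω : Fin N → Ω, ∏ n, w (ω n) = 1 := by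
  rw [sum_pi_prod, h1, one_pow]

/-- The moment generating function of a variable of negative mean drops below `1`. -/
theorem exists_sum_mul_exp_lt_one {Ω : Type*} [Fintype Ω] {w g : Ω → ℝ}
    (h1 : ∑ a, w a = 1) (hg : ∑ a, w a * g a < 0) :
    ∃ s : ℝ, 0 < s ∧ ∑ a, w a * Real.exp (s * g a) < 1 := by
  -- At `s = 0` the generating function equals `1` and its derivative is the mean, which is
  -- negative.
  have hd : HasDerivAt (fun s : ℝ => ∑ a, w a * Real.exp (s * g a)) (∑ a, w a * g a) 0 := by
    refine HasDerivAt.fun_sum fun a _ => ?_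
    have := (((hasDerivAt_id (0 : ℝ)).mul_const (g a)).exp).const_mul (w a)
    simpa using this
  have h := (hasDerivAt_iff_tendsto_slope.mp hd).eventually (gt_mem_nhds hg)
  have h' : ∀ᶠ s in 𝓝[>] (0 : ℝ), slope (fun s : ℝ => ∑ a, w a * Real.exp (s * g a)) 0 s < 0 :=
    h.filter_mono (nhdsWithin_mono _ fun s hs => (ne_of_gt hs))
  obtain ⟨s, hs, hpos⟩ := (h'.and self_mem_nhdsWithin).exists
  have hpos : 0 < s := hpos
  refine ⟨s, hpos, ?_⟩
  rw [slope_def_field] at hs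
  have := (div_neg_iff.mp hs).resolve_left fun h => by linarith [h.2]
  simp only [zero_mul, Real.exp_zero, mul_one, h1] at this
  linarith [this.1]

/-- Exponential Markov inequality: on the event, `exp (t ∑ (f - μ - δ))` is at least `1`, and its
full expectation factorises into an `N`-th power. -/
theorem exists_upper_tail_bound {Ω : Type*} [Fintype Ω] {w : Ω → ℝ} (hw : ∀ a, 0 ≤ w a)
    (h1 : ∑ a, w a = 1) (f : Ω → ℝ) {δ : ℝ} (hδ : 0 < δ) :
    ∃ r : ℝ, 0 < r ∧ r < 1 ∧ ∀ (N : ℕ) (s : Finset (Fin N → Ω)),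
      (∀ ω ∈ s, N * (∑ a, w a * f a + δ) < ∑ n, f (ω n)) →
        ∑ ω ∈ s, ∏ n, w (ω n) ≤ r ^ N := by
  set μ := ∑ a, w a * f a
  obtain ⟨t, ht, hlt⟩ := exists_sum_mul_exp_lt_one (g := fun a => f a - μ - δ) h1 (by
    simp only [mul_sub, Finset.sum_sub_distrib, ← Finset.sum_mul, h1]
    simp only [μ]; linarith)
  -- The maximum with `1 / 2` makes the base visibly positive.
  refine ⟨max (∑ a, w a * Real.exp (t * (f a - μ - δ))) (1 / 2),
    lt_max_of_lt_right (by norm_num), max_lt hlt (by norm_num), fun N s hs => ?_⟩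
  calc ∑ ω ∈ s, ∏ n, w (ω n)
      ≤ ∑ ω ∈ s, ∏ n, (w (ω n) * Real.exp (t * (f (ω n) - μ - δ))) := by
        refine Finset.sum_le_sum fun ω hω => ?_
        rw [Finset.prod_mul_distrib, ← Real.exp_sum, ← Finset.mul_sum]
        refine le_mul_of_one_le_right (Finset.prod_nonneg fun n _ => hw _) (Real.one_le_exp ?_)
        have := hs ω hω
        refine mul_nonneg ht.le ?_
        simp only [Finset.sum_sub_distrib, Finset.sum_const, Finset.card_univ, Fintype.card_fin,
          nsmul_eq_mul]
        linarith
    _ ≤ ∑ ω : Fin N → Ω, ∏ n, (w (ω n) * Real.exp (t * (f (ω n) - μ - δ))) :=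
        Finset.sum_le_sum_of_subset_of_nonneg (Finset.subset_univ _) fun ω _ _ =>
          Finset.prod_nonneg fun n _ => mul_nonneg (hw _) (Real.exp_pos _).le
    _ = (∑ a, w a * Real.exp (t * (f a - μ - δ))) ^ N :=
        sum_pi_prod N fun a => w a * Real.exp (t * (f a - μ - δ))
    _ ≤ _ := pow_le_pow_left₀
        (Finset.sum_nonneg fun a _ => mul_nonneg (hw _) (Real.exp_pos _).le) (le_max_left _ _) N

/-- Chernoff bound: the empirical mean of `N` independent samples from a finite distribution is
at distance at least `δ` from the mean with exponentially small probability. -/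
theorem exists_tail_bound {Ω : Type*} [Fintype Ω] {w : Ω → ℝ} (hw : ∀ a, 0 ≤ w a)
    (h1 : ∑ a, w a = 1) (f : Ω → ℝ) {δ : ℝ} (hδ : 0 < δ) :
    ∃ r : ℝ, 0 < r ∧ r < 1 ∧ ∀ (N : ℕ), 0 < N → ∀ s : Finset (Fin N → Ω),
      (∀ ω ∈ s, (∀ n, w (ω n) ≠ 0) →
        δ < |1 / (N : ℝ) * ∑ n, f (ω n) - ∑ a, w a * f a|) →
        ∑ ω ∈ s, ∏ n, w (ω n) ≤ 2 * r ^ N := by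
  classical
  obtain ⟨r, hr0, hr1, hr⟩ := exists_upper_tail_bound hw h1 f hδ
  obtain ⟨q, hq0, hq1, hq⟩ := exists_upper_tail_bound hw h1 (fun a => -f a) hδ
  refine ⟨max r q, lt_max_of_lt_left hr0, max_lt hr1 hq1, fun N hN s hs => ?_⟩
  have hN' : (0 : ℝ) < N := by exact_mod_cast hN
  set μ := ∑ a, w a * f a with hμ
  have hr' := hr N (s.filter fun ω => N * (μ + δ) < ∑ n, f (ω n))
    fun ω hω => (Finset.mem_filter.mp hω).2
  have hq' := hq N (s.filter fun ω => N * (∑ a, w a * -f a + δ) < ∑ n, -f (ω n))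
    fun ω hω => (Finset.mem_filter.mp hω).2
  have h2 : ∑ ω ∈ s, ∏ n, w (ω n) ≤
      ∑ ω ∈ s.filter (fun ω => N * (μ + δ) < ∑ n, f (ω n)), ∏ n, w (ω n) +
      ∑ ω ∈ s.filter (fun ω => N * (∑ a, w a * -f a + δ) < ∑ n, -f (ω n)), ∏ n, w (ω n) := by
    rw [Finset.sum_filter, Finset.sum_filter, ← Finset.sum_add_distrib]
    refine Finset.sum_le_sum fun ω hω => ?_
    have hnn : 0 ≤ ∏ n, w (ω n) := Finset.prod_nonneg fun n _ => hw _
    -- Sequences of weight zero contribute nothing, so a deviation is required only on the support.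
    -- In the applications, labels with a zero eigenvalue are atypical whatever their sample
    -- entropy.
    by_cases hz : ∀ n, w (ω n) ≠ 0
    · have := hs ω hω hz
      simp only [mul_neg, Finset.sum_neg_distrib]
      rcases lt_abs.mp this with h | h
      · rw [if_pos]
        · split_ifs <;> linarith
        · have := mul_lt_mul_of_pos_left h hN'
          rw [mul_sub, ← mul_assoc, mul_one_div_cancel hN'.ne'] at this
          linarith
      · rw [add_comm, if_pos]
        · split_ifs <;> linarith
        · have := mul_lt_mul_of_pos_left h hN'
          rw [mul_neg, mul_sub, ← mul_assoc, mul_one_div_cancel hN'.ne'] at this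
          linarith
    · push Not at hz
      obtain ⟨n, hn⟩ := hz
      rw [Finset.prod_eq_zero (Finset.mem_univ n) hn]
      simp
  have := pow_le_pow_left₀ hr0.le (le_max_left r q) N
  have := pow_le_pow_left₀ hq0.le (le_max_right r q) N
  linarith

/-- Redrawing one coordinate of an independent sample does not change an average. -/
theorem sum_prod_resample {K A : Type*} [Fintype K] [DecidableEq K] [Fintype A] {q : A → ℝ}
    (hq : ∑ a, q a = 1) (k : K) (f : (K → A) → ℝ) :
    ∑ C : K → A, (∏ i, q (C i)) * f C =
      ∑ C : K → A, (∏ i, q (C i)) * ∑ a, q a * f (Function.update C k a) := by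
  -- Swapping coordinate `k` with a fresh independent sample is an involution preserving the weight.
  let e : (K → A) × A ≃ (K → A) × A :=
    { toFun := fun c => (Function.update c.1 k c.2, c.1 k)
      invFun := fun c => (Function.update c.1 k c.2, c.1 k)
      left_inv := fun c => by simp
      right_inv := fun c => by simp }
  calc ∑ C : K → A, (∏ i, q (C i)) * f C
      = ∑ c : (K → A) × A, ((∏ i, q (c.1 i)) * q c.2) * f c.1 := by
        rw [Fintype.sum_prod_type]
        refine Finset.sum_congr rfl fun C _ => ?_
        simp only
        rw [← Finset.sum_mul, ← Finset.mul_sum, hq, mul_one]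
    _ = ∑ c : (K → A) × A, ((∏ i, q ((e c).1 i)) * q (e c).2) * f (e c).1 :=
        (Equiv.sum_comp e fun c => ((∏ i, q (c.1 i)) * q c.2) * f c.1).symm
    _ = ∑ c : (K → A) × A, ((∏ i, q (c.1 i)) * q c.2) * f (Function.update c.1 k c.2) := by
        refine Finset.sum_congr rfl fun c _ => ?_
        simp only [e, Equiv.coe_fn_mk]
        congr 1
        rw [← Finset.mul_prod_erase _ _ (Finset.mem_univ k),
          ← Finset.mul_prod_erase _ (fun i => q (c.1 i)) (Finset.mem_univ k),
          Function.update_self, Finset.prod_congr rfl fun i hi => by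
            rw [Function.update_of_ne (Finset.ne_of_mem_erase hi)]]
        ring
    _ = _ := by
        rw [Fintype.sum_prod_type]
        refine Finset.sum_congr rfl fun C _ => ?_
        rw [Finset.mul_sum]
        exact Finset.sum_congr rfl fun a _ => by ring

end Probability

/-! ### Averages over random codes. -/

section CodeAverage

variable {X d : Type*} [Fintype X] [Fintype d] (S : QSource X d) {N m : ℕ}

/-- Probability of a word whose letters are sampled independently from the source. -/
def wordProb (x : Fin N → X) : ℝ := ∏ n, S.p (x n)

theorem wordProb_nonneg (x : Fin N → X) : 0 ≤ wordProb S x :=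
  Finset.prod_nonneg fun _ _ => S.p_nonneg _

theorem sum_wordProb : ∑ x : Fin N → X, wordProb S x = 1 :=
  sum_pi_prod_eq_one N S.p_sum

theorem codeProb_nonneg (C : Codebook X N m) : 0 ≤ codeProb S C :=
  Finset.prod_nonneg fun _ _ => wordProb_nonneg S _

theorem sum_codeProb : ∑ C : Codebook X N m, codeProb S C = 1 := by
  classical
  have := (Finset.prod_univ_sum
    (fun _ : Fin m → Bool => (Finset.univ : Finset (Fin N → X)))
    (fun _ x => wordProb S x)).symm
  simp only [Fintype.piFinset_univ, sum_wordProb, Finset.prod_const_one] at this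
  exact this

theorem codeAvg_const (c : ℝ) : codeAvg S (fun _ : Codebook X N m => c) = c := by
  rw [codeAvg, ← Finset.sum_mul, sum_codeProb, one_mul]

theorem codeAvg_mono {f g : Codebook X N m → ℝ} (h : ∀ C, f C ≤ g C) :
    codeAvg S f ≤ codeAvg S g :=
  Finset.sum_le_sum fun C _ => mul_le_mul_of_nonneg_left (h C) (codeProb_nonneg S C)

theorem codeAvg_sub (f g : Codebook X N m → ℝ) :
    codeAvg S (fun C => f C - g C) = codeAvg S f - codeAvg S g := by
  simp only [codeAvg, mul_sub, Finset.sum_sub_distrib]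

theorem codeAvg_const_mul (c : ℝ) (f : Codebook X N m → ℝ) :
    codeAvg S (fun C => c * f C) = c * codeAvg S f := by
  simp only [codeAvg, Finset.mul_sum]
  exact Finset.sum_congr rfl fun _ _ => by ring

theorem codeAvg_sum {ι : Type*} (s : Finset ι) (f : ι → Codebook X N m → ℝ) :
    codeAvg S (fun C => ∑ i ∈ s, f i C) = ∑ i ∈ s, codeAvg S (f i) := by
  simp only [codeAvg, Finset.mul_sum]
  exact Finset.sum_comm

theorem codeAvg_resample (k : Fin m → Bool) (f : Codebook X N m → ℝ) :
    codeAvg S f = codeAvg S fun C => ∑ x, wordProb S x * f (Function.update C k x) :=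
  sum_prod_resample (sum_wordProb S) k f

theorem codeAvg_word (k : Fin m → Bool) (g : (Fin N → X) → ℝ) :
    codeAvg S (fun C : Codebook X N m => g (C k)) = ∑ x, wordProb S x * g x := by
  rw [codeAvg_resample S k]
  simp only [Function.update_self]
  exact codeAvg_const S _

theorem exists_codeAvg_le (f : Codebook X N m → ℝ) : ∃ C, codeAvg S f ≤ f C := by
  by_contra! h
  have hpos : ∃ C : Codebook X N m, 0 < codeProb S C := by
    by_contra! h0
    have := Finset.sum_nonpos fun C (_ : C ∈ Finset.univ) => h0 C
    rw [sum_codeProb] at this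
    linarith
  obtain ⟨C₀, hC₀⟩ := hpos
  have : codeAvg S f < codeAvg S fun _ : Codebook X N m => codeAvg S f :=
    Finset.sum_lt_sum
      (fun C _ => mul_le_mul_of_nonneg_left (h C).le (codeProb_nonneg S C))
      ⟨C₀, Finset.mem_univ _, mul_lt_mul_of_pos_left (h C₀) hC₀⟩
  rw [codeAvg_const] at this
  exact lt_irrefl _ this

end CodeAverage

/-! ### Spectral decomposition of product operators. -/

section Tensor

open Matrix

variable {d : Type*} [Fintype d] {N : ℕ}

theorem sum_pi_prod_apply {R : Type*} [CommSemiring R] (g : Fin N → d → R) :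
    ∑ j : Fin N → d, ∏ n, g n (j n) = ∏ n, ∑ a, g n a := by
  classical
  have := (Finset.prod_univ_sum (fun _ : Fin N => (Finset.univ : Finset d)) g).symm
  simpa [Fintype.piFinset_univ] using this

theorem inner_tensorVec (v w : Fin N → EuclideanSpace ℂ d) :
    inner ℂ (tensorVec v) (tensorVec w) = ∏ n, inner ℂ (v n) (w n) := by
  simp only [tensorVec, PiLp.inner_apply, RCLike.inner_apply, map_prod, ← Finset.prod_mul_distrib]
  exact sum_pi_prod_apply fun n i => (w n) i * (starRingEnd ℂ) ((v n) i)

variable [DecidableEq d] {A : Fin N → Matrix d d ℂ} (hA : ∀ n, (A n).IsHermitian)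

/-- Product eigenvalues of `A₁ ⊗ ⋯ ⊗ A_N`. -/
noncomputable def prodEig (j : Fin N → d) : ℝ := ∏ n, (hA n).eigenvalues (j n)

/-- Product eigenvectors of `A₁ ⊗ ⋯ ⊗ A_N`. -/
noncomputable def prodVec (j : Fin N → d) : EuclideanSpace ℂ (Fin N → d) :=
  tensorVec fun n => (hA n).eigenvectorBasis (j n)

theorem orthonormal_prodVec : Orthonormal ℂ (prodVec hA) := by
  rw [orthonormal_iff_ite]
  intro i j
  simp only [prodVec, inner_tensorVec,
    fun n => orthonormal_iff_ite.mp (hA n).eigenvectorBasis.orthonormal (i n) (j n)]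
  split_ifs with h
  · simp [h]
  · obtain ⟨n, hn⟩ := Function.ne_iff.mp h
    exact Finset.prod_eq_zero (Finset.mem_univ n) (by simp [hn])

theorem norm_prodVec (j : Fin N → d) : ‖prodVec hA j‖ = 1 := (orthonormal_prodVec hA).1 j

/-- The product eigenvectors form an orthonormal basis. -/
noncomputable def prodBasis : OrthonormalBasis (Fin N → d) ℂ (EuclideanSpace ℂ (Fin N → d)) :=
  OrthonormalBasis.mk (orthonormal_prodVec hA)
    ((orthonormal_prodVec hA).linearIndependent.span_eq_top_of_card_eq_finrank' (by simp)).ge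

theorem coe_prodBasis : ⇑(prodBasis hA) = prodVec hA := OrthonormalBasis.coe_mk _ _

theorem _root_.Matrix.IsHermitian.apply_eq_sum {B : Matrix d d ℂ} (hB : B.IsHermitian) (a b : d) :
    B a b = ∑ j, (hB.eigenvalues j : ℂ) *
      (hB.eigenvectorBasis j a * star (hB.eigenvectorBasis j b)) := by
  conv_lhs => rw [hB.spectral_theorem, Unitary.conjStarAlgAut_apply]
  simp only [Matrix.mul_apply, Matrix.diagonal_apply, Matrix.star_apply,
    Matrix.IsHermitian.eigenvectorUnitary_apply, Function.comp_apply, mul_ite, mul_zero,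
    Finset.sum_ite_eq', Finset.mem_univ, if_true]
  exact Finset.sum_congr rfl fun j _ => by simp; ring

theorem tensorMat_eq_sum :
    tensorMat A = ∑ j, (prodEig hA j : ℂ) •
      vecMulVec (prodVec hA j).ofLp (star (prodVec hA j).ofLp) := by
  ext a b
  simp only [tensorMat, Matrix.of_apply, Matrix.sum_apply, Matrix.smul_apply, vecMulVec_apply,
    prodEig, prodVec, tensorVec, Pi.star_apply, star_prod, smul_eq_mul, Complex.ofReal_prod,
    ← Finset.prod_mul_distrib]
  rw [sum_pi_prod_apply fun n i => ((hA n).eigenvalues i : ℂ) *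
      ((hA n).eigenvectorBasis i (a n) * star ((hA n).eigenvectorBasis i (b n)))]
  exact Finset.prod_congr rfl fun n _ => (hA n).apply_eq_sum _ _

/-- `Re Tr[B† B (A₁ ⊗ ⋯ ⊗ A_N)]` in the product eigenbasis. -/
theorem trace_mul_tensorMat (B : Matrix (Fin N → d) (Fin N → d) ℂ) :
    (Bᴴ * B * tensorMat A).trace.re =
      ∑ j, prodEig hA j * ‖toEuclideanCLM (𝕜 := ℂ) B (prodVec hA j)‖ ^ 2 := by
  rw [tensorMat_eq_sum hA, Matrix.mul_sum, Matrix.trace_sum, Complex.re_sum]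
  refine Finset.sum_congr rfl fun j _ => ?_
  rw [Matrix.mul_smul, Matrix.trace_smul, Matrix.mul_vecMulVec, Matrix.trace_vecMulVec,
    smul_eq_mul, Complex.re_ofReal_mul]
  congr 1
  rw [← Matrix.mulVec_mulVec, ← inner_self_eq_norm_sq (𝕜 := ℂ), EuclideanSpace.inner_eq_star_dotProduct,
    ofLp_toEuclideanCLM, Matrix.star_mulVec, dotProduct_comm, Matrix.dotProduct_mulVec,
    dotProduct_comm]
  simp

theorem prodEig_nonneg (h : ∀ n, (A n).PosSemidef) (j : Fin N → d) :
    0 ≤ prodEig hA j := Finset.prod_nonneg fun n _ => (h n).eigenvalues_nonneg _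

theorem sum_eigenvalues_eq_one {B : Matrix d d ℂ} (hB : B.IsHermitian) (h : B.trace = 1) :
    ∑ j, hB.eigenvalues j = 1 := by
  have := hB.trace_eq_sum_eigenvalues
  rw [h] at this
  have := congrArg Complex.re this
  simpa using this.symm

theorem sum_prodEig (h : ∀ n, (A n).trace = 1) : ∑ j, prodEig hA j = 1 := by
  unfold prodEig
  rw [sum_pi_prod_apply fun n i => (hA n).eigenvalues i]
  exact Finset.prod_eq_one fun n _ => sum_eigenvalues_eq_one _ (h n)

end Tensor

/-! ### Projectors onto spans and their matrices. -/

section Projection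

open Matrix

theorem starProjection_span_image {ι E : Type*} [NormedAddCommGroup E] [InnerProductSpace ℂ E]
    [FiniteDimensional ℂ E] {v : ι → E} (hv : Orthonormal ℂ v) (s : Set ι) [DecidablePred (· ∈ s)]
    (j : ι) : (Submodule.span ℂ (v '' s)).starProjection (v j) = if j ∈ s then v j else 0 := by
  split_ifs with h
  · exact Submodule.starProjection_eq_self_iff.mpr
      (Submodule.subset_span (Set.mem_image_of_mem v h))
  · rw [Submodule.starProjection_apply_eq_zero_iff, Submodule.mem_orthogonal]
    intro u hu
    induction hu using Submodule.span_induction with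
    | mem x hx =>
      obtain ⟨i, hi, rfl⟩ := hx
      exact hv.2 fun hij => h (hij ▸ hi)
    | zero => exact inner_zero_left _
    | add x y _ _ hx hy => rw [inner_add_left, hx, hy, add_zero]
    | smul a x _ hx => rw [inner_smul_left, hx, mul_zero]

/-- The trace of a projection is its rank, and it may be computed in any orthonormal basis. -/
theorem sum_norm_starProjection_sq {ι E : Type*} [Fintype ι] [NormedAddCommGroup E]
    [InnerProductSpace ℂ E] [FiniteDimensional ℂ E] (b : OrthonormalBasis ι ℂ E)
    (U : Submodule ℂ E) :
    ∑ i, ‖U.starProjection (b i)‖ ^ 2 = Module.finrank ℂ U := by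
  have h1 := LinearMap.trace_eq_sum_inner (U.starProjection : E →ₗ[ℂ] E) b
  have h2 : LinearMap.IsProj U (U.starProjection : E →ₗ[ℂ] E) :=
    ⟨fun x => U.starProjection_apply_mem x,
      fun x hx => Submodule.starProjection_eq_self_iff.mpr hx⟩
  rw [h2.trace] at h1
  have h3 := congrArg Complex.re h1
  rw [Complex.natCast_re, Complex.re_sum] at h3
  rw [h3]
  refine Finset.sum_congr rfl fun i _ => ?_
  have := U.re_inner_starProjection_eq_normSq (b i)
  rw [← inner_conj_symm, Complex.conj_re]
  simpa using this.symm

variable {ι : Type*} [Fintype ι] [DecidableEq ι]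

theorem toEuclideanCLM_projMat (U : Submodule ℂ (EuclideanSpace ℂ ι)) :
    toEuclideanCLM (𝕜 := ℂ) (projMat U) = U.starProjection :=
  (toEuclideanCLM (n := ι) (𝕜 := ℂ)).apply_symm_apply _

theorem projMat_orthogonal (U : Submodule ℂ (EuclideanSpace ℂ ι)) :
    projMat Uᗮ = 1 - projMat U := by
  refine (toEuclideanCLM (n := ι) (𝕜 := ℂ)).injective
    (show toEuclideanCLM (𝕜 := ℂ) _ = toEuclideanCLM (𝕜 := ℂ) _ from ?_)
  rw [map_sub, map_one, toEuclideanCLM_projMat, toEuclideanCLM_projMat,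
    Submodule.starProjection_orthogonal]
  rfl

theorem projMat_conjTranspose (U : Submodule ℂ (EuclideanSpace ℂ ι)) :
    (projMat U)ᴴ = projMat U := (isStarProjection_projMat U).isSelfAdjoint

theorem projMat_mul_self (U : Submodule ℂ (EuclideanSpace ℂ ι)) :
    projMat U * projMat U = projMat U := (isStarProjection_projMat U).isIdempotentElem

theorem sqrt_projMat (U : Submodule ℂ (EuclideanSpace ℂ ι)) :
    CFC.sqrt (projMat U) = projMat U :=
  CFC.sqrt_unique (projMat_mul_self U) (isStarProjection_projMat U).nonneg

end Projection

/-! ### Defects of successive projections. -/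

section VectorBounds

variable {E : Type*} [NormedAddCommGroup E] [InnerProductSpace ℂ E] [FiniteDimensional ℂ E]

theorem norm_starProjection_orthogonal_sq (U : Submodule ℂ E) (v : E) :
    ‖Uᗮ.starProjection v‖ ^ 2 = ‖v‖ ^ 2 - ‖U.starProjection v‖ ^ 2 := by
  have := U.norm_sq_eq_add_norm_sq_starProjection v
  linarith

/-- Two successive projections, in terms of the defects of each. -/
theorem norm_starProjection_starProjection_sq_ge (U V : Submodule ℂ E) (v : E) :
    ‖v‖ ^ 2 - 3 * ‖Vᗮ.starProjection v‖ ^ 2 - 2 * ‖Uᗮ.starProjection v‖ ^ 2 ≤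
      ‖U.starProjection (V.starProjection v)‖ ^ 2 := by
  have h1 : Uᗮ.starProjection (V.starProjection v) =
      Uᗮ.starProjection v - Uᗮ.starProjection (Vᗮ.starProjection v) := by
    rw [← map_sub]
    congr 1
    rw [eq_sub_iff_add_eq, Submodule.starProjection_add_starProjection_orthogonal]
  have h2 : ‖Uᗮ.starProjection (V.starProjection v)‖ ≤
      ‖Uᗮ.starProjection v‖ + ‖Vᗮ.starProjection v‖ := by
    rw [h1]
    exact (norm_sub_le _ _).trans (by gcongr; exact Submodule.norm_starProjection_apply_le _ _)
  have h3 := norm_starProjection_orthogonal_sq U (V.starProjection v)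
  have h4 := norm_starProjection_orthogonal_sq V v
  have h5 := pow_le_pow_left₀ (norm_nonneg _) h2 2
  -- By `(a + b)² ≤ 2a² + 2b²`; the third copy of the `V`-defect comes from `‖V v‖² = ‖v‖² - ‖Vᗮ
  -- v‖²`.
  nlinarith [sq_nonneg (‖Uᗮ.starProjection v‖ - ‖Vᗮ.starProjection v‖)]

/-- Failing one projection is controlled by failing it after another one. -/
theorem norm_starProjection_orthogonal_sq_le (U V : Submodule ℂ E) (v : E) :
    ‖Uᗮ.starProjection v‖ ^ 2 ≤
      2 * (‖v‖ ^ 2 - ‖U.starProjection (V.starProjection v)‖ ^ 2) := by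
  have h1 : Uᗮ.starProjection v =
      Uᗮ.starProjection (V.starProjection v) + Uᗮ.starProjection (Vᗮ.starProjection v) := by
    rw [← map_add, Submodule.starProjection_add_starProjection_orthogonal]
  have h2 : ‖Uᗮ.starProjection v‖ ≤
      ‖Uᗮ.starProjection (V.starProjection v)‖ + ‖Vᗮ.starProjection v‖ := by
    rw [h1]
    exact (norm_add_le _ _).trans (by gcongr; exact Submodule.norm_starProjection_apply_le _ _)
  have h3 := norm_starProjection_orthogonal_sq U (V.starProjection v)
  have h4 := norm_starProjection_orthogonal_sq V v
  have h5 := pow_le_pow_left₀ (norm_nonneg _) h2 2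
  -- After `(a + b)² ≤ 2a² + 2b²` the two terms telescope through `‖V v‖²`.
  nlinarith [sq_nonneg (‖Uᗮ.starProjection (V.starProjection v)‖ - ‖Vᗮ.starProjection v‖)]

/-- Applies the projections onto the listed subspaces, the last one of the list first. -/
noncomputable def seqProj (l : List (Submodule ℂ E)) (v : E) : E :=
  l.foldr (fun U w => U.starProjection w) v

theorem norm_seqProj_le (l : List (Submodule ℂ E)) (v : E) : ‖seqProj l v‖ ≤ ‖v‖ := by
  induction l with
  | nil => exact le_rfl
  | cons U l ih => exact (Submodule.norm_starProjection_apply_le _ _).trans ih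

/-- Telescoping: projections are contractions, so every defect can be measured on the initial vector
rather than on the disturbed one. -/
theorem norm_sub_seqProj_le (l : List (Submodule ℂ E)) (v : E) :
    ‖v - seqProj l v‖ ≤ (l.map fun U : Submodule ℂ E => ‖Uᗮ.starProjection v‖).sum := by
  induction l with
  | nil => simp [seqProj]
  | cons U l ih =>
    have h : v - seqProj (U :: l) v = Uᗮ.starProjection v + U.starProjection (v - seqProj l v) := by
      rw [map_sub, ← add_sub_assoc, add_comm (Uᗮ.starProjection v),
        Submodule.starProjection_add_starProjection_orthogonal]
      rfl
    rw [h, List.map_cons, List.sum_cons]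
    exact (norm_add_le _ _).trans (by
      gcongr
      exact (Submodule.norm_starProjection_apply_le _ _).trans ih)

/-- A quantum union bound for sequential projections. -/
theorem norm_seqProj_ofFn_sq_ge {m : ℕ} (U : Fin m → Submodule ℂ E)
    {v : E} (hv : ‖v‖ = 1) {c : ℝ} (hc : 0 < c) :
    1 - c - c⁻¹ * (m * ∑ i, ‖(U i)ᗮ.starProjection v‖ ^ 2) ≤
      ‖seqProj (List.ofFn U).reverse v‖ ^ 2 := by
  set w := seqProj (List.ofFn U).reverse v
  have h1 : ‖v - w‖ ≤ ∑ i, ‖(U i)ᗮ.starProjection v‖ := by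
    have := norm_sub_seqProj_le (List.ofFn U).reverse v
    rw [List.map_reverse, List.sum_reverse, List.map_ofFn, List.sum_ofFn] at this
    exact this
  have h2 : ‖v - w‖ ^ 2 ≤ m * ∑ i, ‖(U i)ᗮ.starProjection v‖ ^ 2 := by
    refine (pow_le_pow_left₀ (norm_nonneg _) h1 2).trans ?_
    simpa using sq_sum_le_card_mul_sum_sq (s := Finset.univ)
      (f := fun i => ‖(U i)ᗮ.starProjection v‖)
  have h3 : 1 ≤ ‖w‖ + ‖v - w‖ := by
    rw [← hv]
    calc ‖v‖ = ‖w + (v - w)‖ := by simp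
      _ ≤ _ := norm_add_le _ _
  have h5 : ‖w‖ ≤ 1 := hv ▸ norm_seqProj_le _ v
  -- The free parameter `c` replaces a square root by a bound linear in the squared defects, which
  -- can then be averaged over eigenvectors and codes.
  have h4 : 2 * ‖v - w‖ ≤ c + c⁻¹ * ‖v - w‖ ^ 2 := by
    have : c + c⁻¹ * ‖v - w‖ ^ 2 - 2 * ‖v - w‖ = c⁻¹ * (c - ‖v - w‖) ^ 2 := by
      field_simp
      ring
    have := mul_nonneg (inv_pos.mpr hc).le (sq_nonneg (c - ‖v - w‖))
    linarith
  have h6 := mul_le_mul_of_nonneg_left h2 (inv_pos.mpr hc).le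
  have h7 : 1 - 2 * ‖v - w‖ ≤ ‖w‖ ^ 2 := by
    nlinarith [norm_nonneg (v - w), norm_nonneg w]
  linarith

end VectorBounds

/-! ### Projected product states in eigenbasis coordinates. -/

section Trace

open Matrix

variable {d : Type*} [Fintype d] [DecidableEq d] {N : ℕ} {A : Fin N → Matrix d d ℂ}
  (hA : ∀ n, (A n).IsHermitian)

theorem trace_projMat_sandwich (U V : Submodule ℂ (EuclideanSpace ℂ (Fin N → d))) :
    (projMat U * (projMat V * tensorMat A * projMat V)).trace.re =
      ∑ j, prodEig hA j * ‖U.starProjection (V.starProjection (prodVec hA j))‖ ^ 2 := by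
  have h : (projMat U * (projMat V * tensorMat A * projMat V)).trace =
      ((projMat U * projMat V)ᴴ * (projMat U * projMat V) * tensorMat A).trace := by
    rw [conjTranspose_mul, projMat_conjTranspose, projMat_conjTranspose, ← Matrix.mul_assoc,
      Matrix.trace_mul_comm]
    simp only [Matrix.mul_assoc]
    rw [← Matrix.mul_assoc (projMat U) (projMat U), projMat_mul_self]
  rw [h, trace_mul_tensorMat hA]
  refine Finset.sum_congr rfl fun j _ => ?_
  rw [map_mul, toEuclideanCLM_projMat, toEuclideanCLM_projMat]
  rfl

theorem prod_eq_two_rpow {lam : Fin N → ℝ} (h : ∀ n, 0 < lam n) :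
    ∏ n, lam n = (2 : ℝ) ^ ∑ n, Real.logb 2 (lam n) := by
  rw [Real.rpow_sum_of_pos (by norm_num)]
  exact Finset.prod_congr rfl fun n _ => (Real.rpow_logb (by norm_num) (by norm_num) (h n)).symm

end Trace

theorem finrank_biSup_le {ι E : Type*} [Fintype ι] [AddCommGroup E] [Module ℂ E]
    [FiniteDimensional ℂ E] (s : Set ι) (V : ι → Submodule ℂ E) {B : ℝ}
    (hB : ∀ i, (Module.finrank ℂ (V i) : ℝ) ≤ B) :
    (Module.finrank ℂ (⨆ i ∈ s, V i : Submodule ℂ E) : ℝ) ≤ Fintype.card ι * B := by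
  classical
  -- Enlarging `s` to all indices is harmless: the full number of codewords is affordable below the
  -- rate threshold.
  have h1 : (⨆ i ∈ s, V i) ≤ Finset.univ.sup V :=
    iSup₂_le fun i _ => Finset.le_sup (f := V) (Finset.mem_univ i)
  have h2 : ∀ t : Finset ι, (Module.finrank ℂ (t.sup V : Submodule ℂ E) : ℝ) ≤ t.card * B := by
    intro t
    induction t using Finset.induction_on with
    | empty => simp
    | insert a t ha ih =>
      rw [Finset.sup_insert, Finset.card_insert_of_notMem ha]
      have : (Module.finrank ℂ (V a ⊔ t.sup V : Submodule ℂ E) : ℝ) ≤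
          Module.finrank ℂ (V a) + Module.finrank ℂ (t.sup V : Submodule ℂ E) := by
        exact_mod_cast Submodule.finrank_add_le_finrank_add_finrank _ _
      push_cast
      linarith [hB a]
  exact (Nat.cast_le.mpr (Submodule.finrank_mono h1)).trans (h2 Finset.univ)

/-! ### Typical and conditionally typical subspaces. -/

section Source

open Matrix

variable {X d : Type*} [Fintype X] [Fintype d] (S : QSource X d)

theorem avgState_posSemidef : S.avgState.PosSemidef :=
  Matrix.posSemidef_sum _ fun x _ =>
    (S.ρ_pos x).smul (Complex.zero_le_real.mpr (S.p_nonneg x))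

theorem avgState_trace : S.avgState.trace = 1 := by
  simp only [QSource.avgState, Matrix.trace_sum, Matrix.trace_smul, S.ρ_trace, smul_eq_mul, mul_one]
  exact_mod_cast S.p_sum

/-- Letters are independent, so averaging commutes with the tensor product. -/
theorem sum_wordProb_smul_codeState (N : ℕ) :
    ∑ x : Fin N → X, (wordProb S x : ℂ) • codeState S x = tensorMat fun _ => S.avgState := by
  ext a b
  simp only [codeState, tensorMat, Matrix.of_apply, Matrix.sum_apply, Matrix.smul_apply, wordProb,
    smul_eq_mul, Complex.ofReal_prod, ← Finset.prod_mul_distrib, QSource.avgState]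
  exact sum_pi_prod_apply fun n x => (S.p x : ℂ) * S.ρ x (a n) (b n)

theorem sum_wordProb_trace {N : ℕ} (M P : Matrix (Fin N → d) (Fin N → d) ℂ) :
    ∑ x, wordProb S x * (M * (P * codeState S x * P)).trace.re =
      (M * (P * tensorMat (fun _ => S.avgState) * P)).trace.re := by
  rw [← sum_wordProb_smul_codeState]
  simp only [Matrix.mul_sum, Matrix.sum_mul, Matrix.trace_sum, Complex.re_sum, Matrix.mul_smul,
    Matrix.smul_mul, Matrix.trace_smul, smul_eq_mul, Complex.re_ofReal_mul]

theorem avgState_hermitian_family (N : ℕ) : ∀ _ : Fin N, S.avgState.IsHermitian :=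
  fun _ => S.avgState_isHermitian

theorem letter_hermitian_family {N : ℕ} (x : Fin N → X) : ∀ n, (S.ρ (x n)).IsHermitian :=
  fun n => (S.ρ_pos (x n)).1

variable [DecidableEq d]

theorem norm_typicalSpace_orthogonal_sq {δ : ℝ} {N : ℕ} (j : Fin N → d)
    [DecidablePred (· ∈ S.typicalSet δ N)] :
    ‖(S.typicalSpace δ N)ᗮ.starProjection (prodVec (avgState_hermitian_family S N) j)‖ ^ 2 =
      if j ∈ S.typicalSet δ N then 0 else 1 := by
  rw [norm_starProjection_orthogonal_sq, norm_prodVec]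
  have := starProjection_span_image (orthonormal_prodVec (avgState_hermitian_family S N))
    (S.typicalSet δ N) j
  change 1 ^ 2 - ‖(Submodule.span ℂ (prodVec (avgState_hermitian_family S N) ''
    S.typicalSet δ N)).starProjection _‖ ^ 2 = _
  rw [this]
  split_ifs <;> simp [norm_prodVec]

/-- The typical subspace carries all but an exponentially small part of the average state. -/
theorem exists_typicalSpace_tail {δ : ℝ} (hδ : 0 < δ) :
    ∃ r : ℝ, 0 < r ∧ r < 1 ∧ ∀ N : ℕ, 0 < N →
      ∑ j, prodEig (avgState_hermitian_family S N) j *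
        ‖(S.typicalSpace δ N)ᗮ.starProjection
          (prodVec (avgState_hermitian_family S N) j)‖ ^ 2 ≤ 2 * r ^ N := by
  classical
  -- The spectrum is a probability distribution, and the mean of `-log₂ λ` under it is the entropy.
  obtain ⟨r, h0, h1, h⟩ := exists_tail_bound
    (fun j => (avgState_posSemidef S).eigenvalues_nonneg j)
    (sum_eigenvalues_eq_one S.avgState_isHermitian (avgState_trace S))
    (fun j => -Real.logb 2 (S.avgState_isHermitian.eigenvalues j)) hδ
  refine ⟨r, h0, h1, fun N hN => ?_⟩
  refine le_trans (le_of_eq ?_)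
    (h N hN (Finset.univ.filter fun j => j ∉ S.typicalSet δ N) fun j hj hz => ?_)
  · rw [Finset.sum_filter]
    refine Finset.sum_congr rfl fun j _ => ?_
    rw [norm_typicalSpace_orthogonal_sq, ite_not, mul_ite, mul_zero, mul_one]
    rfl
  · have hj := (Finset.mem_filter.mp hj).2
    by_contra! hle
    refine hj ⟨fun n => lt_of_le_of_ne ((avgState_posSemidef S).eigenvalues_nonneg _)
      (hz n).symm, ?_⟩
    simp only [Finset.sum_neg_distrib, mul_neg] at hle
    simpa only [entropy, neg_mul] using hle

theorem prodEig_le_of_mem_typicalSet {δ : ℝ} {N : ℕ} (hN : 0 < N) {j : Fin N → d}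
    (hj : j ∈ S.typicalSet δ N) :
    prodEig (avgState_hermitian_family S N) j ≤
      (2 : ℝ) ^ (-(N * (entropy S.avgState_isHermitian - δ))) := by
  have hN' : (0 : ℝ) < N := by exact_mod_cast hN
  rw [prodEig, prod_eq_two_rpow hj.1]
  refine Real.rpow_le_rpow_of_exponent_le one_le_two ?_
  have h := mul_le_mul_of_nonneg_left (abs_le.mp hj.2).1 hN'.le
  rw [mul_sub, ← mul_assoc, mul_neg, mul_neg, mul_one_div_cancel hN'.ne'] at h
  linarith

theorem le_prodEig_of_mem_condTypicalSet {δ : ℝ} {N : ℕ} (hN : 0 < N) {x : Fin N → X}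
    {j : Fin N → d} (hj : j ∈ S.condTypicalSet δ x) :
    (2 : ℝ) ^ (-(N * (S.condEntropy + δ))) ≤ prodEig (letter_hermitian_family S x) j := by
  have hN' : (0 : ℝ) < N := by exact_mod_cast hN
  rw [prodEig, prod_eq_two_rpow hj.1]
  refine Real.rpow_le_rpow_of_exponent_le one_le_two ?_
  have h := mul_le_mul_of_nonneg_left (abs_le.mp hj.2).2 hN'.le
  rw [mul_sub, ← mul_assoc, mul_neg, mul_one_div_cancel hN'.ne'] at h
  linarith

/-- Counting: each typical label has weight at least `2^(-N(condEntropy + δ))`, and the weights sum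
to `1`. -/
theorem finrank_condTypicalSpace_le {δ : ℝ} {N : ℕ} (hN : 0 < N) (x : Fin N → X) :
    (Module.finrank ℂ (S.condTypicalSpace δ x) : ℝ) ≤ (2 : ℝ) ^ (N * (S.condEntropy + δ)) := by
  classical
  set s : Finset (Fin N → d) := Finset.univ.filter fun j => j ∈ S.condTypicalSet δ x
  have h1 : Module.finrank ℂ (S.condTypicalSpace δ x) ≤ s.card := by
    have : S.condTypicalSpace δ x = Submodule.span ℂ
        ((s.image (prodVec (letter_hermitian_family S x)) : Finset _) : Set _) := by
      simp only [s, Finset.coe_image, Finset.coe_filter, Finset.mem_univ, true_and, Set.ofPred_mem_eq]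
      rfl
    rw [this]
    exact (finrank_span_finset_le_card _).trans Finset.card_image_le
  have h2 : s.card * (2 : ℝ) ^ (-(N * (S.condEntropy + δ))) ≤ 1 := by
    rw [← sum_prodEig (letter_hermitian_family S x) fun n => S.ρ_trace (x n), ← nsmul_eq_mul]
    exact (Finset.card_nsmul_le_sum s _ _ fun j hj =>
      le_prodEig_of_mem_condTypicalSet S hN (Finset.mem_filter.mp hj).2).trans
      (Finset.sum_le_sum_of_subset_of_nonneg (Finset.subset_univ s) fun j _ _ =>
        prodEig_nonneg _ (fun n => S.ρ_pos (x n)) j)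
  have h3 : (0 : ℝ) < 2 ^ (N * (S.condEntropy + δ)) := Real.rpow_pos_of_pos two_pos _
  rw [Real.rpow_neg two_pos.le, ← div_eq_mul_inv, div_le_one h3] at h2
  exact (Nat.cast_le.mpr h1).trans h2

open Classical in
/-- Codewords are conditionally typical up to an exponentially small probability. -/
theorem exists_condTypicalSet_tail {δ : ℝ} (hδ : 0 < δ) :
    ∃ r : ℝ, 0 < r ∧ r < 1 ∧ ∀ N : ℕ, 0 < N →
      ∑ x : Fin N → X, wordProb S x * ∑ j, prodEig (letter_hermitian_family S x) j *
        (if j ∈ S.condTypicalSet δ x then 0 else 1) ≤ 2 * r ^ N := by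
  -- The samples are pairs of a letter and an eigenvalue index, drawn jointly with probability `pₓ
  -- λ_{j|x}`.
  obtain ⟨r, h0, h1, h⟩ := exists_tail_bound
    (w := fun a : X × d => S.p a.1 * (S.ρ_pos a.1).1.eigenvalues a.2)
    (fun a => mul_nonneg (S.p_nonneg _) ((S.ρ_pos a.1).eigenvalues_nonneg _))
    (by simp only [Fintype.sum_prod_type, ← Finset.mul_sum,
          fun x => sum_eigenvalues_eq_one (S.ρ_pos x).1 (S.ρ_trace x), mul_one, S.p_sum])
    (fun a => -Real.logb 2 ((S.ρ_pos a.1).1.eigenvalues a.2)) hδ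
  have hmean : ∑ a : X × d, S.p a.1 * (S.ρ_pos a.1).1.eigenvalues a.2 *
      -Real.logb 2 ((S.ρ_pos a.1).1.eigenvalues a.2) = S.condEntropy := by
    rw [Fintype.sum_prod_type]
    refine Finset.sum_congr rfl fun x _ => ?_
    simp only [entropy, mul_neg, Finset.sum_neg_distrib, mul_assoc, ← Finset.mul_sum]
  rw [hmean] at h
  refine ⟨r, h0, h1, fun N hN => ?_⟩
  refine le_trans (le_of_eq ?_) (h N hN
    (Finset.univ.filter fun ω => (fun n => (ω n).2) ∉ S.condTypicalSet δ fun n => (ω n).1)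
    fun ω hω hz => ?_)
  · rw [Finset.sum_filter, ← Equiv.sum_comp
      (Equiv.arrowProdEquivProdArrow (Fin N) (fun _ => X) (fun _ => d)).symm,
      Fintype.sum_prod_type]
    refine Finset.sum_congr rfl fun x _ => ?_
    rw [Finset.mul_sum]
    refine Finset.sum_congr rfl fun j _ => ?_
    simp only [Equiv.arrowProdEquivProdArrow_symm_apply, Finset.prod_mul_distrib, ite_not, mul_ite,
      mul_zero, mul_one]
    rfl
  · have hω := (Finset.mem_filter.mp hω).2
    by_contra! hle
    refine hω ⟨fun n => lt_of_le_of_ne ((S.ρ_pos _).eigenvalues_nonneg _)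
      (right_ne_zero_of_mul (hz n)).symm, ?_⟩
    simp only [Finset.sum_neg_distrib, mul_neg] at hle
    simpa only [neg_mul] using hle

end Source

/-! ### Acceptance at each step and the success probability. -/

section Decoding

open Matrix Filter Topology

variable {X d : Type*} [Fintype X] [Fintype d] [DecidableEq d] (S : QSource X d)
  {δ : ℝ} {N m : ℕ}

/-- The subspace onto which the decoder projects at step `u` along the path `k`. -/
noncomputable def pathSpace (δ : ℝ) (C : Codebook X N m) (k : Fin m → Bool) (u : Fin m) :
    Submodule ℂ (EuclideanSpace ℂ (Fin N → d)) :=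
  bif k u then (zeroSpace S δ C u (bitPrefix k u))ᗮ else zeroSpace S δ C u (bitPrefix k u)

theorem elem_projDecoder (C : Codebook X N m) (k : Fin m → Bool) (u : Fin m) :
    (projDecoder S δ C).elem k u = projMat (pathSpace S δ C k u) := by
  simp only [BinaryTree.elem, projDecoder, pathSpace]
  cases k u
  · rfl
  · simp [projMat_orthogonal]

theorem trace_elem_projDecoder (C : Codebook X N m) (k : Fin m → Bool) (u : Fin m)
    (V : Submodule ℂ (EuclideanSpace ℂ (Fin N → d))) (x : Fin N → X) :
    ((projDecoder S δ C).elem k u * (projMat V * codeState S x * projMat V)).trace.re =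
      ∑ j, prodEig (letter_hermitian_family S x) j *
        ‖(pathSpace S δ C k u).starProjection
          (V.starProjection (prodVec (letter_hermitian_family S x) j))‖ ^ 2 := by
  rw [elem_projDecoder, codeState, trace_projMat_sandwich]

theorem sum_prodEig_letter (x : Fin N → X) :
    ∑ j, prodEig (letter_hermitian_family S x) j = 1 :=
  sum_prodEig _ fun n => S.ρ_trace (x n)

theorem prodEig_letter_nonneg (x : Fin N → X) (j : Fin N → d) :
    0 ≤ prodEig (letter_hermitian_family S x) j :=
  prodEig_nonneg _ (fun n => S.ρ_pos (x n)) j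

theorem trace_projMat_codeState (V : Submodule ℂ (EuclideanSpace ℂ (Fin N → d)))
    {A : Fin N → Matrix d d ℂ} (hA : ∀ n, (A n).IsHermitian) :
    (projMat V * (1 * tensorMat A * 1)).trace.re =
      ∑ j, prodEig hA j * ‖V.starProjection (prodVec hA j)‖ ^ 2 := by
  have h := trace_projMat_sandwich hA V ⊤
  have h1 : projMat (⊤ : Submodule ℂ (EuclideanSpace ℂ (Fin N → d))) = 1 := by
    rw [projMat, Submodule.starProjection_top']
    exact map_one _
  rw [h1] at h
  simpa [Submodule.starProjection_top] using h

/-- The part of a random codeword outside a subspace, averaged over the codeword. -/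
theorem sum_wordProb_defect (V : Submodule ℂ (EuclideanSpace ℂ (Fin N → d))) :
    ∑ x, wordProb S x * ∑ j, prodEig (letter_hermitian_family S x) j *
        ‖V.starProjection (prodVec (letter_hermitian_family S x) j)‖ ^ 2 =
      ∑ j, prodEig (avgState_hermitian_family S N) j *
        ‖V.starProjection (prodVec (avgState_hermitian_family S N) j)‖ ^ 2 := by
  -- The eigenbasis varies with the word, so the comparison passes through traces, which are linear
  -- in the state.
  simp only [← trace_projMat_codeState]
  exact sum_wordProb_trace S (projMat V) 1

open Classical in
theorem norm_orthogonal_sq_le_of_le (x : Fin N → X)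
    {U : Submodule ℂ (EuclideanSpace ℂ (Fin N → d))} (hU : S.condTypicalSpace δ x ≤ U)
    (j : Fin N → d) :
    ‖Uᗮ.starProjection (prodVec (letter_hermitian_family S x) j)‖ ^ 2 ≤
      if j ∈ S.condTypicalSet δ x then 0 else 1 := by
  split_ifs with h
  · have hm : prodVec (letter_hermitian_family S x) j ∈ U :=
      hU (Submodule.subset_span (Set.mem_image_of_mem _ h))
    rw [norm_starProjection_orthogonal_sq, Submodule.starProjection_eq_self_iff.mpr hm, sub_self]
  · rw [norm_starProjection_orthogonal_sq, norm_prodVec]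
    nlinarith [sq_nonneg ‖U.starProjection (prodVec (letter_hermitian_family S x) j)‖]

theorem condTypicalSpace_le_pathSpace (C : Codebook X N m) (k : Fin m → Bool) (u : Fin m)
    (hk : k u = false) : S.condTypicalSpace δ (C k) ≤ pathSpace S δ C k u := by
  rw [pathSpace, hk, cond_false, zeroSpace]
  exact le_iSup₂_of_le (f := fun k' (_ : k' ∈ subcode u (bitPrefix k u) false) =>
    S.condTypicalSpace δ (C k')) k ⟨rfl, hk⟩ le_rfl

/-- A label whose bit is `1` lies outside the `0`-branch. This independence is what permits
redrawing its codeword. -/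
theorem zeroSpace_update (C : Codebook X N m) (k : Fin m → Bool) (u : Fin m)
    (hk : k u = true) (x : Fin N → X) :
    zeroSpace S δ (Function.update C k x) u (bitPrefix k u) =
      zeroSpace S δ C u (bitPrefix k u) := by
  unfold zeroSpace
  refine iSup_congr fun k' => iSup_congr fun hk' => ?_
  rw [Function.update_of_ne]
  rintro rfl
  exact absurd hk'.2 (by simp [hk])

/-- Weight of the typical part of the average state in the span of the competing codewords. -/
theorem trace_zeroSpace_le (hN : 0 < N) (C : Codebook X N m) (u : Fin m) (w : Fin u → Bool) :
    (projMat (zeroSpace S δ C u w) * (projMat (S.typicalSpace δ N) *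
      tensorMat (fun _ => S.avgState) * projMat (S.typicalSpace δ N))).trace.re ≤
      2 ^ m * (2 : ℝ) ^ (N * (2 * δ - S.holevo)) := by
  classical
  rw [trace_projMat_sandwich (avgState_hermitian_family S N)]
  set b := (2 : ℝ) ^ (-(N * (entropy S.avgState_isHermitian - δ)))
  have hb : 0 < b := Real.rpow_pos_of_pos two_pos _
  -- Only typical eigenvectors survive, each of weight at most `b`; the sum then extends to a full
  -- basis and becomes a dimension.
  calc _ ≤ ∑ j, b * ‖(zeroSpace S δ C u w).starProjection
          (prodBasis (avgState_hermitian_family S N) j)‖ ^ 2 := by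
        refine Finset.sum_le_sum fun j _ => ?_
        have h := starProjection_span_image
          (orthonormal_prodVec (avgState_hermitian_family S N)) (S.typicalSet δ N) j
        change (S.typicalSpace δ N).starProjection _ = _ at h
        rw [h, coe_prodBasis]
        split_ifs with hj
        · gcongr
          exact prodEig_le_of_mem_typicalSet S hN hj
        · rw [map_zero, norm_zero]
          simp only [ne_eq, OfNat.ofNat_ne_zero, not_false_eq_true, zero_pow, mul_zero]
          positivity
    _ = b * Module.finrank ℂ (zeroSpace S δ C u w) := by
        rw [← Finset.mul_sum, sum_norm_starProjection_sq]
    _ ≤ b * (Fintype.card (Fin m → Bool) * (2 : ℝ) ^ (N * (S.condEntropy + δ))) := by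
        gcongr
        exact finrank_biSup_le _ (fun k => S.condTypicalSpace δ (C k))
          fun k => finrank_condTypicalSpace_le S hN (C k)
    _ = _ := by
        rw [mul_left_comm, ← Real.rpow_add two_pos]
        simp only [Fintype.card_pi, Fintype.card_bool, Finset.prod_const, Finset.card_univ,
          Fintype.card_fin, Nat.cast_pow, Nat.cast_ofNat, QSource.holevo]
        congr 2
        ring

open Classical in
-- The accepted subspace contains the typical part of the sent codeword whatever the other codewords
-- are, so the number of codewords does not enter.
theorem codeAvg_elem_zero_ge (k : Fin m → Bool) (u : Fin m) (hk : k u = false) :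
    1 - 3 * ∑ j, prodEig (avgState_hermitian_family S N) j *
        ‖(S.typicalSpace δ N)ᗮ.starProjection
          (prodVec (avgState_hermitian_family S N) j)‖ ^ 2 -
      2 * ∑ x : Fin N → X, wordProb S x * ∑ j, prodEig (letter_hermitian_family S x) j *
        (if j ∈ S.condTypicalSet δ x then 0 else 1) ≤
    codeAvg S fun C : Codebook X N m =>
      ((projDecoder S δ C).elem k u * (projMat (S.typicalSpace δ N) * codeState S (C k)
        * projMat (S.typicalSpace δ N))).trace.re := by
  let g : (Fin N → X) → ℝ := fun x => 1 -
    3 * ∑ j, prodEig (letter_hermitian_family S x) j *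
      ‖(S.typicalSpace δ N)ᗮ.starProjection (prodVec (letter_hermitian_family S x) j)‖ ^ 2 -
    2 * ∑ j, prodEig (letter_hermitian_family S x) j *
      (if j ∈ S.condTypicalSet δ x then 0 else 1)
  have h1 : codeAvg S (fun C : Codebook X N m => g (C k)) ≤
      codeAvg S fun C : Codebook X N m =>
        ((projDecoder S δ C).elem k u * (projMat (S.typicalSpace δ N) * codeState S (C k)
          * projMat (S.typicalSpace δ N))).trace.re := by
    refine codeAvg_mono S fun C => ?_
    rw [trace_elem_projDecoder]
    simp only [g]
    conv_lhs => lhs; lhs; rw [← sum_prodEig_letter S (C k)]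
    rw [Finset.mul_sum, Finset.mul_sum, ← Finset.sum_sub_distrib,
      ← Finset.sum_sub_distrib]
    refine Finset.sum_le_sum fun j _ => ?_
    have h2 := norm_starProjection_starProjection_sq_ge (pathSpace S δ C k u)
      (S.typicalSpace δ N) (prodVec (letter_hermitian_family S (C k)) j)
    have h3 := norm_orthogonal_sq_le_of_le S (δ := δ) (C k)
      (condTypicalSpace_le_pathSpace S C k u hk) j
    rw [norm_prodVec] at h2
    have := mul_le_mul_of_nonneg_left
      ((sub_le_sub_left (mul_le_mul_of_nonneg_left h3 zero_le_two) _).trans h2)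
      (prodEig_letter_nonneg S (C k) j)
    linarith
  refine le_trans (le_of_eq ?_) h1
  rw [codeAvg_word, ← sum_wordProb_defect]
  simp only [g, mul_sub, mul_one, Finset.sum_sub_distrib, sum_wordProb, mul_left_comm _ (3 : ℝ),
    mul_left_comm _ (2 : ℝ), ← Finset.mul_sum]

/-- With the other codewords fixed, averaging the sent one yields the product of average states; the
bound therefore holds for every choice of competitors. -/
theorem codeAvg_elem_one_ge (hN : 0 < N) (k : Fin m → Bool) (u : Fin m) (hk : k u = true) :
    1 - ∑ j, prodEig (avgState_hermitian_family S N) j *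
        ‖(S.typicalSpace δ N)ᗮ.starProjection
          (prodVec (avgState_hermitian_family S N) j)‖ ^ 2 -
      2 ^ m * (2 : ℝ) ^ (N * (2 * δ - S.holevo)) ≤
    codeAvg S fun C : Codebook X N m =>
      ((projDecoder S δ C).elem k u * (projMat (S.typicalSpace δ N) * codeState S (C k)
        * projMat (S.typicalSpace δ N))).trace.re := by
  rw [codeAvg_resample S k, ← codeAvg_const S (m := m) (1 - _ - _)]
  refine codeAvg_mono S fun C => ?_
  have h : ∀ x, (projDecoder S δ (Function.update C k x)).elem k u =
      1 - projMat (zeroSpace S δ C u (bitPrefix k u)) := fun x => by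
    rw [elem_projDecoder, pathSpace, hk, cond_true, zeroSpace_update S C k u hk, projMat_orthogonal]
  simp only [h, Function.update_self]
  rw [sum_wordProb_trace, ← projMat_orthogonal,
    trace_projMat_sandwich (avgState_hermitian_family S N)]
  have h2 := trace_zeroSpace_le S (δ := δ) hN C u (bitPrefix k u)
  rw [trace_projMat_sandwich (avgState_hermitian_family S N)] at h2
  have h3 := sum_prodEig (avgState_hermitian_family S N) fun _ => avgState_trace S
  simp only [norm_starProjection_orthogonal_sq, norm_prodVec, mul_sub, one_pow, mul_one,
    Finset.sum_sub_distrib, h3] at h2 ⊢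
  linarith

theorem sufficientCondition_projDecoder {R : ℝ} (hδ : 0 < δ) (hR0 : 0 ≤ R)
    (hR : R < S.holevo - 2 * δ) :
    SufficientCondition S δ (numBits R) fun _ C => projDecoder S δ C := by
  classical
  obtain ⟨r, hr0, hr1, hr⟩ := exists_typicalSpace_tail S hδ
  obtain ⟨q, hq0, hq1, hq⟩ := exists_condTypicalSet_tail S hδ
  set t : ℝ := (2 : ℝ) ^ (R + 2 * δ - S.holevo)
  have ht0 : 0 < t := Real.rpow_pos_of_pos two_pos _
  have ht1 : t < 1 := Real.rpow_lt_one_of_one_lt_of_neg one_lt_two (by linarith)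
  -- Both tails are at most twice a geometric term: bit `0` costs `3 · 2 r^N + 2 · 2 q^N`, bit `1`
  -- costs `2 r^N + 2 t^N`.
  refine ⟨fun N => 6 * r ^ N + 4 * q ^ N + 2 * t ^ N, fun N => by positivity, ?_, ?_⟩
  · have key : ∀ s : ℝ, 0 < s → s < 1 →
        (fun N : ℕ => s ^ N) =o[atTop] fun N : ℕ => ((N : ℝ) ^ 2)⁻¹ := fun s h0 h1 => by
      rw [Asymptotics.isLittleO_iff_tendsto']
      · simp only [div_inv_eq_mul]
        simpa only [mul_comm] using
          tendsto_pow_const_mul_const_pow_of_abs_lt_one 2 (by rwa [abs_of_pos h0])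
      · filter_upwards [eventually_gt_atTop 0] with N hN h
        have : (0 : ℝ) < N := by exact_mod_cast hN
        exact absurd h (by positivity)
    exact (((key r hr0 hr1).const_mul_left 6).add ((key q hq0 hq1).const_mul_left 4)).add
      ((key t ht0 ht1).const_mul_left 2)
  · intro N k u
    -- At `N = 0` there are no bits, hence no step to check.
    have hN : 0 < N := by
      rcases Nat.eq_zero_or_pos N with rfl | h
      · have := u.isLt
        simp [numBits] at this
      · exact h
    -- The factor `2` pays for rounding `N R` up.
    have hpow : (2 : ℝ) ^ numBits R N * (2 : ℝ) ^ (N * (2 * δ - S.holevo)) ≤ 2 * t ^ N := by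
      have h1 : (numBits R N : ℝ) ≤ N * R + 1 := (Nat.ceil_lt_add_one (by positivity)).le
      rw [← Real.rpow_natCast 2 (numBits R N), ← Real.rpow_add two_pos]
      calc (2 : ℝ) ^ ((numBits R N : ℝ) + N * (2 * δ - S.holevo))
          ≤ (2 : ℝ) ^ (1 + (R + 2 * δ - S.holevo) * N) :=
            Real.rpow_le_rpow_of_exponent_le one_le_two (by linarith)
        _ = 2 * t ^ N := by
            rw [Real.rpow_add two_pos, Real.rpow_one, Real.rpow_mul two_pos.le, Real.rpow_natCast]
    have hr' := hr N hN
    have hq' := hq N hN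
    have := pow_pos hr0 N
    have := pow_pos hq0 N
    have := pow_pos ht0 N
    cases hk : k u
    · exact le_trans (by linarith) (codeAvg_elem_zero_ge S (δ := δ) k u hk)
    · exact le_trans (by linarith) (codeAvg_elem_one_ge S (δ := δ) hN k u hk)

theorem toEuclideanCLM_pathOp (C : Codebook X N m) (k : Fin m → Bool)
    (v : EuclideanSpace ℂ (Fin N → d)) :
    toEuclideanCLM (𝕜 := ℂ) ((projDecoder S δ C).pathOp k) v =
      seqProj (List.ofFn (pathSpace S δ C k)).reverse v := by
  have h : (List.ofFn fun u => CFC.sqrt ((projDecoder S δ C).elem k u)) =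
      (List.ofFn (pathSpace S δ C k)).map projMat := by
    rw [List.map_ofFn]
    congr 1
    funext u
    rw [elem_projDecoder, sqrt_projMat, Function.comp_apply]
  rw [BinaryTree.pathOp, h, ← List.map_reverse]
  induction (List.ofFn (pathSpace S δ C k)).reverse with
  | nil => simp [seqProj]
  | cons U l ih =>
    rw [List.map_cons, List.prod_cons, map_mul, mul_apply_eq_comp, ih,
      toEuclideanCLM_projMat]
    rfl

theorem trace_nested (C : Codebook X N m) (k : Fin m → Bool) (x : Fin N → X) :
    ((projDecoder S δ C).nested k * codeState S x).trace.re =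
      ∑ j, prodEig (letter_hermitian_family S x) j *
        ‖seqProj (List.ofFn (pathSpace S δ C k)).reverse
          (prodVec (letter_hermitian_family S x) j)‖ ^ 2 := by
  rw [BinaryTree.nested, codeState, trace_mul_tensorMat (letter_hermitian_family S x)]
  simp only [toEuclideanCLM_pathOp]

theorem trace_nested_le_one (C : Codebook X N m) (k : Fin m → Bool) (x : Fin N → X) :
    ((projDecoder S δ C).nested k * codeState S x).trace.re ≤ 1 := by
  rw [trace_nested, ← sum_prodEig_letter S x]
  refine Finset.sum_le_sum fun j _ => mul_le_of_le_one_right (prodEig_letter_nonneg S x j) ?_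
  have := norm_seqProj_le (List.ofFn (pathSpace S δ C k)).reverse
    (prodVec (letter_hermitian_family S x) j)
  rw [norm_prodVec] at this
  exact pow_le_one₀ (norm_nonneg _) this

/-- The union bound involves defects of the unprojected state, while the step condition concerns the
state compressed by `V`; `norm_starProjection_orthogonal_sq_le` converts between them at the cost of
a factor `2`. -/
theorem trace_nested_ge (C : Codebook X N m) (k : Fin m → Bool) (x : Fin N → X)
    (V : Submodule ℂ (EuclideanSpace ℂ (Fin N → d))) {c : ℝ} (hc : 0 < c) :
    1 - c - c⁻¹ * (m * ∑ u, 2 * (1 - ((projDecoder S δ C).elem k u *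
        (projMat V * codeState S x * projMat V)).trace.re)) ≤
      ((projDecoder S δ C).nested k * codeState S x).trace.re := by
  rw [trace_nested]
  have h1 : ∀ j, 1 - c - c⁻¹ * (m * ∑ u, 2 * (1 - ‖(pathSpace S δ C k u).starProjection
      (V.starProjection (prodVec (letter_hermitian_family S x) j))‖ ^ 2)) ≤
      ‖seqProj (List.ofFn (pathSpace S δ C k)).reverse
          (prodVec (letter_hermitian_family S x) j)‖ ^ 2 := fun j => by
    refine le_trans ?_ (norm_seqProj_ofFn_sq_ge (pathSpace S δ C k)
      (norm_prodVec (letter_hermitian_family S x) j) hc)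
    gcongr with u
    have := norm_starProjection_orthogonal_sq_le (pathSpace S δ C k u) V
      (prodVec (letter_hermitian_family S x) j)
    rwa [norm_prodVec, one_pow] at this
  refine le_trans (le_of_eq ?_) (Finset.sum_le_sum fun j _ =>
    mul_le_mul_of_nonneg_left (h1 j) (prodEig_letter_nonneg S x j))
  have h2 : ∀ u, 1 - ((projDecoder S δ C).elem k u *
        (projMat V * codeState S x * projMat V)).trace.re =
      ∑ j, prodEig (letter_hermitian_family S x) j *
        (1 - ‖(pathSpace S δ C k u).starProjection
          (V.starProjection (prodVec (letter_hermitian_family S x) j))‖ ^ 2) := fun u => by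
    rw [trace_elem_projDecoder]
    simp only [mul_sub, mul_one, Finset.sum_sub_distrib, sum_prodEig_letter]
  simp only [h2]
  rw [← Finset.mul_sum, Finset.sum_comm]
  simp only [mul_sub (prodEig _ _) (1 - c), Finset.sum_sub_distrib, ← Finset.sum_mul,
    sum_prodEig_letter, one_mul, ← Finset.mul_sum, mul_left_comm (prodEig _ _) (c⁻¹),
    mul_left_comm (prodEig _ _) (m : ℝ), mul_left_comm (prodEig _ _) (2 : ℝ)]

theorem successProb_le_one (C : Codebook X N m) :
    successProb S C (projDecoder S δ C) ≤ 1 := by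
  have h : ∑ k, ((projDecoder S δ C).nested k * codeState S (C k)).trace.re ≤ 2 ^ m := by
    refine (Finset.sum_le_sum fun k _ => trace_nested_le_one S C k (C k)).trans ?_
    simp
  rw [successProb, one_div, inv_mul_le_iff₀ (by positivity), mul_one]
  exact h

theorem codeAvg_successProb_ge {ε c : ℝ} (hc : 0 < c)
    (V : Submodule ℂ (EuclideanSpace ℂ (Fin N → d)))
    (hε : ∀ (k : Fin m → Bool) (u : Fin m), 1 - ε ≤ codeAvg S fun C : Codebook X N m =>
      ((projDecoder S δ C).elem k u * (projMat V * codeState S (C k) * projMat V)).trace.re) :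
    1 - c - c⁻¹ * (2 * m ^ 2 * ε) ≤
      codeAvg S fun C : Codebook X N m => successProb S C (projDecoder S δ C) := by
  have h : ∀ k : Fin m → Bool, 1 - c - c⁻¹ * (2 * m ^ 2 * ε) ≤ codeAvg S fun C : Codebook X N m =>
      ((projDecoder S δ C).nested k * codeState S (C k)).trace.re := fun k => by
    refine le_trans ?_ (codeAvg_mono S fun C => trace_nested_ge S C k (C k) V hc)
    rw [codeAvg_sub, codeAvg_const, codeAvg_const_mul, codeAvg_const_mul, codeAvg_sum]
    simp only [codeAvg_const_mul, codeAvg_sub, codeAvg_const]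
    refine sub_le_sub_left (mul_le_mul_of_nonneg_left ?_ (inv_pos.mpr hc).le) _
    calc (m : ℝ) * ∑ u, 2 * (1 - codeAvg S fun C : Codebook X N m =>
          ((projDecoder S δ C).elem k u * (projMat V * codeState S (C k) * projMat V)).trace.re)
        ≤ m * ∑ _u : Fin m, 2 * ε := by
          gcongr with u
          linarith [hε k u]
      _ = 2 * m ^ 2 * ε := by
          simp only [Finset.sum_const, Finset.card_univ, Fintype.card_fin, nsmul_eq_mul]
          ring
  simp only [successProb]
  rw [codeAvg_const_mul, codeAvg_sum, one_div, le_inv_mul_iff₀ (by positivity)]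
  refine le_trans (le_of_eq ?_) (Finset.sum_le_sum fun k _ => h k)
  simp
  ring

theorem tendsto_codeAvg_successProb {R : ℝ} (hR0 : 0 ≤ R)
    (h : SufficientCondition S δ (numBits R) fun _ C => projDecoder S δ C) :
    Tendsto (fun N : ℕ => codeAvg S fun C : Codebook X N (numBits R N) =>
      successProb S C (projDecoder S δ C)) atTop (𝓝 1) := by
  obtain ⟨ε, hε0, hε, hcond⟩ := h
  have hlim : Tendsto (fun N : ℕ => (N : ℝ) ^ 2 * ε N) atTop (𝓝 0) := by
    have := hε.tendsto_div_nhds_zero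
    simpa only [div_inv_eq_mul, mul_comm] using this
  rw [Metric.tendsto_nhds]
  intro η hη
  -- With `c = η / 2` fixed, the remaining loss must fall below the other `η / 2`.
  have hlim' : Tendsto (fun N : ℕ => (η / 2)⁻¹ * (2 * (R + 1) ^ 2) * ((N : ℝ) ^ 2 * ε N))
      atTop (𝓝 0) := by simpa using hlim.const_mul ((η / 2)⁻¹ * (2 * (R + 1) ^ 2))
  filter_upwards [eventually_gt_atTop 0, hlim'.eventually (gt_mem_nhds (half_pos hη))]
    with N hN hsmall
  have hN1 : (1 : ℝ) ≤ N := by exact_mod_cast hN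
  have hm : (numBits R N : ℝ) ≤ N * (R + 1) := by
    have := (Nat.ceil_lt_add_one (by positivity : 0 ≤ (N : ℝ) * R)).le
    have : (numBits R N : ℝ) ≤ N * R + 1 := this
    linarith
  have hlow := codeAvg_successProb_ge S (half_pos hη) (S.typicalSpace δ N) (hcond N)
  have hup : codeAvg S (fun C : Codebook X N (numBits R N) =>
      successProb S C (projDecoder S δ C)) ≤ 1 :=
    (codeAvg_mono S fun C => successProb_le_one S C).trans_eq (codeAvg_const S 1)
  have hbound : (η / 2)⁻¹ * (2 * (numBits R N : ℝ) ^ 2 * ε N) ≤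
      (η / 2)⁻¹ * (2 * (R + 1) ^ 2) * ((N : ℝ) ^ 2 * ε N) := by
    rw [mul_assoc (η / 2)⁻¹]
    have := (hε0 N).le
    calc _ ≤ (η / 2)⁻¹ * (2 * (N * (R + 1)) ^ 2 * ε N) := by gcongr
      _ = _ := by ring
  rw [Real.dist_eq, abs_sub_lt_iff]
  constructor <;> linarith

theorem exists_tendsto_successProb {m : ℕ → ℕ}
    (h : Tendsto (fun N : ℕ => codeAvg S fun C : Codebook X N (m N) =>
      successProb S C (projDecoder S δ C)) atTop (𝓝 1)) :
    ∃ C : (N : ℕ) → Codebook X N (m N),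
      Tendsto (fun N : ℕ => successProb S (C N) (projDecoder S δ (C N))) atTop (𝓝 1) := by
  choose C hC using fun N : ℕ => exists_codeAvg_le S fun C : Codebook X N (m N) =>
    successProb S C (projDecoder S δ C)
  exact ⟨C, tendsto_of_tendsto_of_tendsto_of_le_of_le h tendsto_const_nhds hC
    fun N => successProb_le_one S (C N)⟩

end Decoding

end HolevoTree

theorem lemma4 {X d : Type*} [Fintype X] [Fintype d] [DecidableEq d]
    (S : HolevoTree.QSource X d) :
    (∀ δ R : ℝ, 0 < δ → 0 ≤ R → R < S.holevo - 2 * δ →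
      HolevoTree.SufficientCondition S δ (HolevoTree.numBits R)
        (fun _ C => HolevoTree.projDecoder S δ C) ∧
      Filter.Tendsto
        (fun N : ℕ => HolevoTree.codeAvg S
          fun C : HolevoTree.Codebook X N (HolevoTree.numBits R N) =>
            HolevoTree.successProb S C (HolevoTree.projDecoder S δ C))
        Filter.atTop (nhds 1)) ∧
    (∀ R : ℝ, 0 ≤ R → R < S.holevo →
      ∃ δ : ℝ, 0 < δ ∧ ∃ C : (N : ℕ) → HolevoTree.Codebook X N (HolevoTree.numBits R N),
        Filter.Tendsto
          (fun N : ℕ =>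
            HolevoTree.successProb S (C N) (HolevoTree.projDecoder S δ (C N)))
          Filter.atTop (nhds 1)) := by
  have main {δ R : ℝ} (hδ : 0 < δ) (hR0 : 0 ≤ R) (hR : R < S.holevo - 2 * δ) :=
    HolevoTree.sufficientCondition_projDecoder S hδ hR0 hR
  refine ⟨fun δ R hδ hR0 hR => ⟨main hδ hR0 hR,
    HolevoTree.tendsto_codeAvg_successProb S hR0 (main hδ hR0 hR)⟩, fun R hR0 hR => ?_⟩
  -- A quarter of the gap: `2δ` uses half of it and leaves the rate inequality strict.
  have hδ : 0 < (S.holevo - R) / 4 := by linarith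
  exact ⟨(S.holevo - R) / 4, hδ, HolevoTree.exists_tendsto_successProb S
    (HolevoTree.tendsto_codeAvg_successProb S hR0 (main hδ hR0 (by linarith)))⟩
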